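/- Let $\mathbb T$ be the unit circle, $|d\zeta|$ arc length, $m=|d\zeta|/2\pi$, and let $\mu$ be a finite positive Borel measure on $\mathbb T$. For $f\in L^2(\mathbb T)$ let $f(\xi)$ denote, for individual points $\xi\in\mathbb T$, the non-tangential limit at $\xi$ of the Poisson extension of $f$ whenever it exists. Put $$\mathcal D_\xi(f)=\int_{\mathbb T}\Big|\frac{f(\zeta)-f(\xi)}{\zeta-\xi}\Big|^2dm(\zeta)$$ ($:=\infty$ if $f(\xi)$ does not exist), $\mathcal D_\mu(f)=\int_{\mathbb T}\mathcal D_\xi(f)\,d\mu(\xi)$ and $\|f\|_\mu^2=\|f\|_{L^2(m)}^2+\mathcal D_\mu(f)$. Let $\mathcal D^h(\mu)=\{f\in L^2(\mathbb T):\mathcal D_\mu(f)<\infty\}$ and $\mathcal D(\mu)=\{f\in\mathcal D^h(\mu):\hat f(n)=0\text{ for all }n<0\}$. For $A\subset\mathbb T$ let $$c_\mu(A)=\inf\{\|g\|_\mu^2:\ g\in\mathcal D^h(\mu),\ |g|\ge 1\text{ a.e. on a neighbourhood of }A\};$$ a property holds $c_\mu$-quasi-everywhere if it holds outside a set $A$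 with $c_\mu(A)=0$. For an open arc $I=(e^{ia},e^{ib})=\{e^{it}:a<t<b\}$, $a<b$, with length $|I|$, and for $\gamma>1$, let $\gamma I=(e^{i(a-(\gamma-1)(b-a)/2)},e^{i(b+(\gamma-1)(b-a)/2)})$, and put $$\langle f\rangle_I=\frac1{|I|}\int_I|f|\,|d\zeta|,\qquad \mathcal D_{\gamma I,\mathbb T,\mu}(f)=\int_{\xi\in\mathbb T}\int_{\zeta\in\gamma I}\frac{|f(\zeta)-f(\xi)|^2}{|\zeta-\xi|^2}\,\frac{|d\zeta|}{2\pi}\,d\mu(\xi).$$ **Corollary 3.1.** For every $\gamma>1$ there is a constant $\kappa\in(0,\infty)$ depending only on $\gamma$ such that, for every finite positive Borel measure $\mu$ on $\mathbb T$, every $f\in\mathcal D(\mu)$, every Borel set $E\subset\mathbb T$ such that $f=0$ $c_\mu$-quasi-everywhere on $E$ (that is, the non-tangential limit of $f$ exists and equals $0$ at $c_\mu$-quasi-every point of $E$), and every open arc $I\subset\mathbb T$, $$\langle f\rangle_I^2\le\kappa\,\frac{\mathcal D_{\gamma I,\mathbb T,\mu}(f)+\int_{\gamma I}|f|^2\,|d\zeta|}{\mu(E\cap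 I)}$$ (in $[0,\infty]$, with $x/0=\infty$ for $x>0$ and $0/0=0$). -/

import Mathlib

open MeasureTheory Filter Topology
open scoped ENNReal NNReal

namespace HarmonicDirichlet

/-- The circle carries its Borel `σ`-algebra. -/
noncomputable instance instMeasurableSpaceCircle : MeasurableSpace Circle := borel Circle

instance instBorelSpaceCircle : BorelSpace Circle := ⟨rfl⟩

/-- Arc length measure `|dζ|` on the unit circle (total mass `2π`). -/
noncomputable def arcLength : Measure Circle :=
  Measure.map Circle.exp (volume.restrict (Set.Ioc 0 (2 * Real.pi)))

/-- Normalized arc length measure `|dζ| / 2π`. -/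
noncomputable def normLength : Measure Circle :=
  ENNReal.ofReal (2 * Real.pi)⁻¹ • arcLength

/-- The Fourier coefficient `f̂(n) = ∫ ζ^{-n} f(ζ) |dζ|/2π`. -/
noncomputable def fourierCoef (f : Circle → ℂ) (n : ℤ) : ℂ :=
  ∫ ζ : Circle, (ζ : ℂ) ^ (-n) * f ζ ∂normLength

/-- The Poisson extension of `f` to the unit disc. If `f ∈ L²` has no Fourier coefficients of
negative index, this is the analytic function `∑ f̂(n) zⁿ` of the Hardy space. -/
noncomputable def poissonExt (f : Circle → ℂ) (z : ℂ) : ℂ :=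
  ∫ ζ : Circle, (((1 - ‖z‖ ^ 2) / ‖(ζ : ℂ) - z‖ ^ 2 : ℝ) : ℂ) * f ζ ∂normLength

/-- The non-tangential approach region (Stolz angle) at `ξ` with aperture `α`. It is empty
for `α ≤ 1`. -/
def stolz (ξ : Circle) (α : ℝ) : Set ℂ :=
  {z : ℂ | ‖z‖ < 1 ∧ ‖z - (ξ : ℂ)‖ < α * (1 - ‖z‖)}

/-- `f` has non-tangential limit `c` at the boundary point `ξ`. -/
def HasNTLimit (f : Circle → ℂ) (ξ : Circle) (c : ℂ) : Prop :=
  ∀ α : ℝ, Tendsto (poissonExt f) (𝓝[stolz ξ α] (ξ : ℂ)) (𝓝 c)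

open Classical in
/-- The value `f(ξ)`: the non-tangential limit of `f` at `ξ` if it exists (and `0` otherwise;
this default is never used by the definitions below). -/
noncomputable def bdryValue (f : Circle → ℂ) (ξ : Circle) : ℂ :=
  if h : ∃ c, HasNTLimit f ξ c then h.choose else 0

open Classical in
/-- `∫_{ζ ∈ J} |f(ζ) - f(ξ)|² / |ζ - ξ|² |dζ|/2π`, where the value `f(ξ)` at the individual
point `ξ` is the non-tangential limit; the integral is `∞` where there is no such limit.
In the variable `ζ` only the class of `f` modulo null sets for arc length matters. -/
noncomputable def localDirichletOn (J : Set Circle) (f : Circle → ℂ) (ξ : Circle) : ℝ≥0∞ :=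
  if ∃ c, HasNTLimit f ξ c then
    ∫⁻ ζ in J, ‖f ζ - bdryValue f ξ‖ₑ ^ 2 / ‖(ζ : ℂ) - (ξ : ℂ)‖ₑ ^ 2 ∂normLength
  else ⊤

/-- `𝒟_{J,L,μ}(f)`: `ζ` runs over `J` (arc length), `ξ` runs over `L` (the measure `μ`). -/
noncomputable def dirichletOn (J L : Set Circle) (μ : Measure Circle) (f : Circle → ℂ) : ℝ≥0∞ :=
  ∫⁻ ξ in L, localDirichletOn J f ξ ∂μ

/-- The local Dirichlet integral `𝒟_ξ(f)`. -/
noncomputable def localDirichlet (f : Circle → ℂ) (ξ : Circle) : ℝ≥0∞ :=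
  localDirichletOn Set.univ f ξ

/-- The weighted Dirichlet integral `𝒟_μ(f) = ∫ 𝒟_ξ(f) dμ(ξ)`. -/
noncomputable def dirichlet (μ : Measure Circle) (f : Circle → ℂ) : ℝ≥0∞ :=
  ∫⁻ ξ, localDirichlet f ξ ∂μ

/-- The squared norm `‖f‖_μ² = ‖f‖²_{L²} + 𝒟_μ(f)`. -/
noncomputable def normSq (μ : Measure Circle) (f : Circle → ℂ) : ℝ≥0∞ :=
  ∫⁻ ζ, ‖f ζ‖ₑ ^ 2 ∂normLength + dirichlet μ f

/-- Membership in the harmonically weighted Dirichlet space `𝒟ʰ(μ)`. -/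
def MemDh (μ : Measure Circle) (f : Circle → ℂ) : Prop :=
  MemLp f 2 normLength ∧ dirichlet μ f < ⊤

/-- Membership in the analytic weighted Dirichlet space `𝒟(μ)`. -/
def MemD (μ : Measure Circle) (f : Circle → ℂ) : Prop :=
  MemDh μ f ∧ ∀ n : ℤ, n < 0 → fourierCoef f n = 0

/-- The capacity `c_μ(E)`: the infimum of `‖f‖_μ²` over all `f ∈ 𝒟ʰ(μ)` with `|f| ≥ 1` almost
everywhere on a neighbourhood of `E`. -/
noncomputable def capacity (μ : Measure Circle) (E : Set Circle) : ℝ≥0∞ :=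
  sInf {t : ℝ≥0∞ | ∃ f : Circle → ℂ, MemDh μ f ∧
    (∃ U : Set Circle, IsOpen U ∧ E ⊆ U ∧ ∀ᵐ ζ ∂normLength, ζ ∈ U → 1 ≤ ‖f ζ‖) ∧
    t = normSq μ f}

/-- `f|_E = 0`: the non-tangential limit of `f` exists and is `0` at every point of `E` outside
a set of capacity zero (`c_μ`-quasi-everywhere on `E`). -/
def VanishesOn (μ : Measure Circle) (f : Circle → ℂ) (E : Set Circle) : Prop :=
  capacity μ {ξ | ξ ∈ E ∧ ¬ HasNTLimit f ξ 0} = 0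

/-- The open arc `(e^{ia}, e^{ib}) = {e^{it} : a < t < b}`; it is the whole circle when
`b - a > 2π`. -/
def arc (a b : ℝ) : Set Circle := Circle.exp '' Set.Ioo a b

/-- The arc `γI` for `I = (e^{ia}, e^{ib})`. -/
def dilatedArc (γ a b : ℝ) : Set Circle :=
  arc (a - (γ - 1) * ((b - a) / 2)) (b + (γ - 1) * ((b - a) / 2))

/-- The average `⟨f⟩_J = |J|⁻¹ ∫_J |f(ζ)| |dζ|`. -/
noncomputable def average (J : Set Circle) (f : Circle → ℂ) : ℝ≥0∞ :=
  (∫⁻ ζ in J, ‖f ζ‖ₑ ∂arcLength) / arcLength J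

end HarmonicDirichlet

namespace HarmonicDirichlet

/-! If `f(ξ) = 0` for some `ξ ∈ I`, the local Dirichlet integral at `ξ` is at least `∫_I |f|² / |ζ -
ξ|² |dζ|/2π`, and `|ζ - ξ|² ≤ 4|I|` on `I`. So it dominates `(8π)⁻¹ |I|⁻¹ ∫_I |f|²`, which by
Cauchy–Schwarz dominates `(8π)⁻¹ ⟨f⟩_I²`. Integrating over `E ∩ I` against `μ` gives the claim with
`κ = 8π`, and monotonicity passes from `I` to `γI`. This needs `f(ξ) = 0` for `μ`-almost every `ξ ∈
E`, whereas the assumption is quasi-everywhere. The bridge is `measure_eq_zero_of_capacity_eq_zero`: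
`μ(A)` is at most a finite constant times `c_μ(A)`, by the pointwise bound
`one_le_localDirichlet_add`. -/

/-! ### Lengths of arcs and chords. -/

lemma isOpen_arc (a b : ℝ) : IsOpen (arc a b) :=
  isLocalHomeomorph_circleExp.isOpenMap _ isOpen_Ioo

lemma arc_subset_arc {a b c d : ℝ} (hca : c ≤ a) (hbd : b ≤ d) : arc a b ⊆ arc c d :=
  Set.image_mono (Set.Ioo_subset_Ioo hca hbd)

lemma arcLength_univ : arcLength Set.univ = ENNReal.ofReal (2 * Real.pi) := by
  rw [arcLength, Measure.map_apply (by fun_prop) MeasurableSet.univ]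
  simp

instance : IsFiniteMeasure arcLength :=
  ⟨by rw [arcLength_univ]; exact ENNReal.ofReal_lt_top⟩

lemma normLength_univ : normLength Set.univ = 1 := by
  rw [normLength, Measure.smul_apply, arcLength_univ, smul_eq_mul,
    ← ENNReal.ofReal_mul (by positivity), inv_mul_cancel₀ (by positivity), ENNReal.ofReal_one]

/-- One half of a short arc has no wrap-around, so its length can be read off on `(0, 2π]`. -/
lemma ofReal_le_arcLength_arc (t : ℝ) {ε : ℝ} (hε : ε ≤ Real.pi) :
    ENNReal.ofReal ε ≤ arcLength (arc (t - ε) (t + ε)) := by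
  have hp := Real.pi_pos
  set s := toIocMod Real.two_pi_pos 0 t with hs
  obtain ⟨h0, h1⟩ := toIocMod_mem_Ioc Real.two_pi_pos 0 t
  rw [← hs] at h0 h1
  have hst : ∀ x, Circle.exp (x + toIocDiv Real.two_pi_pos 0 t • (2 * Real.pi)) = Circle.exp x :=
    fun x => Circle.periodic_exp.zsmul _ x
  have ht := toIocMod_add_toIocDiv_zsmul Real.two_pi_pos 0 t
  rw [← hs] at ht
  have key : ∀ u v, 0 ≤ u → v ≤ 2 * Real.pi → s - ε ≤ u → v ≤ s + ε → v - u = ε →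
      ENNReal.ofReal ε ≤ arcLength (arc (t - ε) (t + ε)) := by
    intro u v hu hv hu' hv' huv
    refine le_trans ?_ (Measure.le_map_apply (by fun_prop) _)
    rw [← huv, ← Real.volume_Ioo, Measure.restrict_apply'
      (measurableSet_Ioc : MeasurableSet (Set.Ioc 0 (2 * Real.pi)))]
    refine measure_mono fun x hx => ⟨?_, hu.trans_lt hx.1, hx.2.le.trans hv⟩
    refine ⟨x + toIocDiv Real.two_pi_pos 0 t • (2 * Real.pi), ⟨?_, ?_⟩, hst x⟩
    · linarith [hx.1]
    · linarith [hx.2]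
  by_cases hε0 : ε ≤ 0
  · simp [ENNReal.ofReal_of_nonpos hε0]
  push Not at hε0
  rcases le_total s Real.pi with h | h
  · exact key s (s + ε) h0.le (by linarith) (by linarith) le_rfl (by ring)
  · exact key (s - ε) s (by linarith) (by linarith) le_rfl (by linarith) (by ring)

lemma norm_exp_sub_exp_le (x y : ℝ) :
    ‖(Circle.exp x : ℂ) - (Circle.exp y : ℂ)‖ ≤ |x - y| := by
  have h : (Circle.exp x : ℂ) - (Circle.exp y : ℂ) =
      (Circle.exp y : ℂ) * (Complex.exp (.I * (x - y : ℝ)) - 1) := by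
    have h1 : Circle.exp x = Circle.exp y * Circle.exp (x - y) := by
      rw [← Circle.exp_add]; congr 1; ring
    rw [h1, Circle.coe_mul, Circle.coe_exp (x - y), mul_comm Complex.I]
    ring
  rw [h, norm_mul, Circle.norm_coe, one_mul, ← Real.norm_eq_abs]
  exact Real.norm_exp_I_mul_ofReal_sub_one_le

lemma norm_sub_le_two (ζ ξ : Circle) : ‖(ζ : ℂ) - (ξ : ℂ)‖ ≤ 2 := by
  refine (norm_sub_le _ _).trans ?_
  rw [Circle.norm_coe, Circle.norm_coe]; norm_num

/-- A chord `d` satisfies `d ≤ 2`, hence `d² ≤ 2d`, and `d/2` is at most the length of the arc. A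
bound linear in the length suffices, and it survives arcs that wrap around the circle. -/
lemma enorm_sq_le_arcLength {a b : ℝ} {ζ ξ : Circle} (hζ : ζ ∈ arc a b) (hξ : ξ ∈ arc a b) :
    ‖(ζ : ℂ) - (ξ : ℂ)‖ₑ ^ 2 ≤ 4 * arcLength (arc a b) := by
  obtain ⟨x, hx, rfl⟩ := hζ
  obtain ⟨y, hy, rfl⟩ := hξ
  set d := ‖(Circle.exp x : ℂ) - (Circle.exp y : ℂ)‖
  have hd0 : 0 ≤ d := norm_nonneg _
  have hd2 : d ≤ 2 := norm_sub_le_two _ _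
  have hdb : d ≤ b - a :=
    (norm_exp_sub_exp_le x y).trans (abs_le.2 ⟨by linarith [hx.1, hy.2], by linarith [hx.2, hy.1]⟩)
  have h : ENNReal.ofReal (d / 2) ≤ arcLength (arc a b) :=
    (ofReal_le_arcLength_arc ((a + b) / 2) (by linarith [Real.pi_gt_three])).trans
      (measure_mono (arc_subset_arc (by linarith) (by linarith)))
  calc ‖(Circle.exp x : ℂ) - (Circle.exp y : ℂ)‖ₑ ^ 2 = ENNReal.ofReal (d ^ 2) := by
        rw [← ofReal_norm, ENNReal.ofReal_pow hd0]
    _ ≤ ENNReal.ofReal (4 * (d / 2)) := ENNReal.ofReal_le_ofReal (by nlinarith)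
    _ ≤ 4 * arcLength (arc a b) := by
        rw [ENNReal.ofReal_mul (by norm_num)]
        simpa using mul_le_mul_right h 4

lemma arcLength_arc_ne_zero {a b : ℝ} (hab : a < b) : arcLength (arc a b) ≠ 0 := by
  have hp := Real.pi_pos
  have hm : 0 < min ((b - a) / 2) Real.pi := lt_min (by linarith) hp
  have h : ENNReal.ofReal (min ((b - a) / 2) Real.pi) ≤ arcLength (arc a b) :=
    (ofReal_le_arcLength_arc ((a + b) / 2) (min_le_right _ _)).trans (measure_mono
      (arc_subset_arc (by linarith [min_le_left ((b - a) / 2) Real.pi])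
        (by linarith [min_le_left ((b - a) / 2) Real.pi])))
  exact ((ENNReal.ofReal_pos.2 hm).trans_le h).ne'

/-! ### Uniqueness of non-tangential limits. -/

lemma neBot_nhdsWithin_stolz (ξ : Circle) : (𝓝[stolz ξ 2] (ξ : ℂ)).NeBot := by
  rw [← mem_closure_iff_nhdsWithin_neBot]
  have hlim : Tendsto (fun r : ℝ => (r : ℂ) * (ξ : ℂ)) (𝓝[<] 1) (𝓝 (ξ : ℂ)) := by
    have : Continuous fun r : ℝ => (r : ℂ) * (ξ : ℂ) := by fun_prop
    simpa using (this.tendsto 1).mono_left nhdsWithin_le_nhds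
  refine mem_closure_of_tendsto hlim ?_
  filter_upwards [Ioo_mem_nhdsLT (show (0 : ℝ) < 1 by norm_num)] with r hr
  have h1 : ‖(r : ℂ) * (ξ : ℂ)‖ = r := by
    rw [norm_mul, Circle.norm_coe, mul_one, Complex.norm_real, Real.norm_of_nonneg hr.1.le]
  have h2 : ‖(r : ℂ) * (ξ : ℂ) - ξ‖ = 1 - r := by
    rw [show (r : ℂ) * (ξ : ℂ) - ξ = ((r - 1 : ℝ) : ℂ) * ξ by push_cast; ring, norm_mul,
      Circle.norm_coe, mul_one, Complex.norm_real, Real.norm_of_nonpos (by linarith [hr.2])]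
    ring
  refine ⟨h1.trans_lt hr.2, ?_⟩
  rw [h1, h2]; linarith [hr.2]

lemma HasNTLimit.bdryValue_eq {f : Circle → ℂ} {ξ : Circle} {c : ℂ} (h : HasNTLimit f ξ c) :
    bdryValue f ξ = c := by
  have he : ∃ c, HasNTLimit f ξ c := ⟨c, h⟩
  have := neBot_nhdsWithin_stolz ξ
  rw [bdryValue, dif_pos he]
  exact tendsto_nhds_unique (he.choose_spec 2) (h 2)

/-! ### Sets of capacity zero are `μ`-null. -/

/-- At a point near which `|g| ≥ 1` almost everywhere, `𝒟_ξ(g)` and `‖g‖²` cannot both be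
small. -/
lemma one_le_localDirichlet_add {g : Circle → ℂ} (hg : AEStronglyMeasurable g normLength)
    {U : Set Circle} (hU : IsOpen U) (hgU : ∀ᵐ ζ ∂normLength, ζ ∈ U → 1 ≤ ‖g ζ‖)
    {ξ : Circle} (hξ : ξ ∈ U) :
    1 ≤ 32 * localDirichlet g ξ + 8 * ∫⁻ ζ, ‖g ζ‖ₑ ^ 2 ∂normLength := by
  unfold localDirichlet localDirichletOn
  split_ifs with hex
  swap
  · simp
  rw [Measure.restrict_univ]
  set c := bdryValue g ξ
  set F : Circle → ℝ≥0∞ := fun ζ => ‖g ζ - c‖ₑ ^ 2 / ‖(ζ : ℂ) - (ξ : ℂ)‖ₑ ^ 2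
  rcases le_or_gt (1 / 2) ‖c‖ with hc | hc
  -- Large boundary value: `1/4 ≤ ‖c‖² ≤ 2(‖g ζ - c‖² + ‖g ζ‖²)` gives the factor 8, and `‖ζ - ξ‖² ≤
  -- 4` turns it into 32.
  · have hpt : ∀ ζ, 1 ≤ 32 * F ζ + 8 * ‖g ζ‖ₑ ^ 2 := by
      intro ζ
      have h1 : ‖g ζ - c‖ₑ ^ 2 / 4 ≤ F ζ := by
        refine ENNReal.div_le_div_left ?_ _
        rw [← ofReal_norm, ← ENNReal.ofReal_pow (norm_nonneg _)]
        refine ENNReal.ofReal_le_of_le_toReal ?_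
        have := norm_sub_le_two ζ ξ
        have := norm_nonneg ((ζ : ℂ) - (ξ : ℂ))
        norm_num; nlinarith
      have h2 : (1 : ℝ≥0∞) ≤ 8 * ‖g ζ - c‖ₑ ^ 2 + 8 * ‖g ζ‖ₑ ^ 2 := by
        have h3 : (1 : ℝ) ≤ 8 * ‖g ζ - c‖ ^ 2 + 8 * ‖g ζ‖ ^ 2 := by
          have : ‖c‖ ≤ ‖g ζ - c‖ + ‖g ζ‖ := by
            rw [norm_sub_rev]; simpa using norm_add_le (c - g ζ) (g ζ)
          nlinarith [sq_nonneg (‖g ζ - c‖ - ‖g ζ‖), norm_nonneg (g ζ - c), norm_nonneg (g ζ)]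
        have h4 := ENNReal.ofReal_le_ofReal h3
        rwa [ENNReal.ofReal_one, ENNReal.ofReal_add (by positivity) (by positivity),
          ENNReal.ofReal_mul (by norm_num), ENNReal.ofReal_mul (by norm_num),
          ENNReal.ofReal_pow (norm_nonneg _), ENNReal.ofReal_pow (norm_nonneg _), ofReal_norm,
          ofReal_norm, ENNReal.ofReal_ofNat] at h4
      calc (1 : ℝ≥0∞) ≤ 8 * ‖g ζ - c‖ₑ ^ 2 + 8 * ‖g ζ‖ₑ ^ 2 := h2
        _ = 32 * (‖g ζ - c‖ₑ ^ 2 / 4) + 8 * ‖g ζ‖ₑ ^ 2 := by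
            congr 1
            rw [← mul_div_assoc, mul_comm, mul_comm (32 : ℝ≥0∞), mul_div_assoc]
            congr 1
            rw [ENNReal.eq_div_iff (by norm_num) (by norm_num)]; norm_num
        _ ≤ _ := by gcongr
    calc (1 : ℝ≥0∞) = ∫⁻ _, 1 ∂normLength := by rw [lintegral_one, normLength_univ]
      _ ≤ ∫⁻ ζ, (32 * F ζ + 8 * ‖g ζ‖ₑ ^ 2) ∂normLength := lintegral_mono hpt
      _ = _ := by
          rw [lintegral_add_right' _ ((hg.enorm.pow_const 2).const_mul 8),
            lintegral_const_mul' _ _ (by norm_num), lintegral_const_mul' _ _ (by norm_num)]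
  -- Small boundary value: `‖g - c‖ ≥ 1/2` almost everywhere near `ξ`, so the singular kernel alone
  -- gives at least `1/(8πε)`, and `ε ≤ 1`.
  · refine le_trans ?_ le_self_add
    obtain ⟨t, rfl⟩ := Circle.exp_surjective ξ
    obtain ⟨δ, hδ, hball⟩ := Metric.isOpen_iff.1 (hU.preimage Circle.exp.continuous) t hξ
    set ε := min δ 1
    have hε : 0 < ε := lt_min hδ one_pos
    have hp := Real.pi_gt_three
    have hsub : arc (t - ε) (t + ε) ⊆ U := by
      rintro _ ⟨x, hx, rfl⟩
      refine hball ?_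
      rw [Metric.mem_ball, Real.dist_eq, abs_lt]
      exact ⟨by linarith [hx.1, min_le_left δ 1], by linarith [hx.2, min_le_left δ 1]⟩
    have hlow : ∀ᵐ ζ ∂normLength, ζ ∈ arc (t - ε) (t + ε) →
        ENNReal.ofReal (1 / (4 * ε ^ 2)) ≤ F ζ := by
      filter_upwards [hgU] with ζ h hζ
      have h1 : 1 / 2 ≤ ‖g ζ - c‖ := by
        linarith [h (hsub hζ), norm_sub_norm_le (g ζ) c]
      have h2 : ‖(ζ : ℂ) - (Circle.exp t : ℂ)‖ ≤ ε := by
        obtain ⟨x, hx, rfl⟩ := hζ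
        exact (norm_exp_sub_exp_le x t).trans
          (abs_le.2 ⟨by linarith [hx.1], by linarith [hx.2]⟩)
      rw [show 1 / (4 * ε ^ 2) = (1 / 2) ^ 2 / ε ^ 2 by ring,
        ENNReal.ofReal_div_of_pos (by positivity), ENNReal.ofReal_pow (by norm_num),
        ENNReal.ofReal_pow hε.le]
      simp only [F, ← ofReal_norm]
      gcongr
    calc (1 : ℝ≥0∞) ≤ ENNReal.ofReal
            (32 * (1 / (4 * ε ^ 2) * ((2 * Real.pi)⁻¹ * ε))) := by
          rw [ENNReal.one_le_ofReal]
          have : 32 * (1 / (4 * ε ^ 2) * ((2 * Real.pi)⁻¹ * ε)) = 4 / (Real.pi * ε) := by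
            field_simp; norm_num
          rw [this, one_le_div (by positivity)]
          have := min_le_right δ 1
          have := Real.pi_lt_four
          nlinarith
      _ = 32 * (ENNReal.ofReal (1 / (4 * ε ^ 2)) *
            (ENNReal.ofReal (2 * Real.pi)⁻¹ * ENNReal.ofReal ε)) := by
          rw [ENNReal.ofReal_mul (by norm_num), ENNReal.ofReal_mul (by positivity),
            ENNReal.ofReal_mul (by positivity), ENNReal.ofReal_ofNat]
      _ ≤ 32 * (ENNReal.ofReal (1 / (4 * ε ^ 2)) * normLength (arc (t - ε) (t + ε))) := by
          rw [normLength, Measure.smul_apply, smul_eq_mul]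
          gcongr
          exact ofReal_le_arcLength_arc t (by linarith [min_le_right δ 1])
      _ = 32 * ∫⁻ _ in arc (t - ε) (t + ε), ENNReal.ofReal (1 / (4 * ε ^ 2)) ∂normLength := by
          rw [setLIntegral_const]
      _ ≤ 32 * ∫⁻ ζ in arc (t - ε) (t + ε), F ζ ∂normLength := by
          gcongr 32 * ?_
          exact setLIntegral_mono_ae' (isOpen_arc _ _).measurableSet hlow
      _ ≤ 32 * ∫⁻ ζ, F ζ ∂normLength := by
          gcongr 32 * ?_
          exact setLIntegral_le_lintegral _ _

lemma measure_le_normSq {μ : Measure Circle} {g : Circle → ℂ}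
    (hg : AEStronglyMeasurable g normLength) {U : Set Circle} (hU : IsOpen U)
    (hgU : ∀ᵐ ζ ∂normLength, ζ ∈ U → 1 ≤ ‖g ζ‖) :
    μ U ≤ (32 + 8 * μ Set.univ) * normSq μ g := by
  calc μ U = ∫⁻ _ in U, 1 ∂μ := by simp
    _ ≤ ∫⁻ ξ in U, (32 * localDirichlet g ξ + 8 * ∫⁻ ζ, ‖g ζ‖ₑ ^ 2 ∂normLength) ∂μ :=
        setLIntegral_mono' hU.measurableSet fun ξ hξ => one_le_localDirichlet_add hg hU hgU hξ
    _ ≤ ∫⁻ ξ, (32 * localDirichlet g ξ + 8 * ∫⁻ ζ, ‖g ζ‖ₑ ^ 2 ∂normLength) ∂μ :=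
        setLIntegral_le_lintegral _ _
    _ = 32 * dirichlet μ g + 8 * μ Set.univ * ∫⁻ ζ, ‖g ζ‖ₑ ^ 2 ∂normLength := by
        -- Splitting off the constant summand avoids any measurability of `ξ ↦ 𝒟_ξ(g)`.
        rw [lintegral_add_right _ measurable_const, lintegral_const_mul' _ _ (by norm_num),
          lintegral_const, dirichlet, mul_right_comm]
    _ ≤ (32 + 8 * μ Set.univ) * normSq μ g := by
        rw [normSq, add_mul]
        gcongr
        · exact le_add_self
        · exact le_self_add

lemma measure_eq_zero_of_capacity_eq_zero {μ : Measure Circle} [IsFiniteMeasure μ]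
    {A : Set Circle} (hA : capacity μ A = 0) : μ A = 0 := by
  have h : μ A / (32 + 8 * μ Set.univ) ≤ capacity μ A := by
    refine le_sInf ?_
    rintro _ ⟨g, hg, ⟨U, hU, hAU, hgU⟩, rfl⟩
    exact ENNReal.div_le_of_le_mul' ((measure_mono hAU).trans
      (measure_le_normSq hg.1.aestronglyMeasurable hU hgU))
  rw [hA, nonpos_iff_eq_zero, ENNReal.div_eq_zero_iff] at h
  refine h.resolve_right ?_
  exact ENNReal.add_ne_top.2 ⟨by norm_num, ENNReal.mul_ne_top (by norm_num) (measure_ne_top _ _)⟩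

/-! ### Cauchy–Schwarz, and the lower bound at zeros of `f`. -/

lemma sq_lintegral_le {α : Type*} [MeasurableSpace α] (ν : Measure α) {F : α → ℝ≥0∞}
    (hF : AEMeasurable F ν) : (∫⁻ x, F x ∂ν) ^ 2 ≤ (∫⁻ x, F x ^ 2 ∂ν) * ν Set.univ := by
  have h := ENNReal.lintegral_mul_le_Lp_mul_Lq ν Real.HolderConjugate.two_two hF
    (aemeasurable_const (b := (1 : ℝ≥0∞)))
  simp only [Pi.mul_apply, mul_one, ENNReal.rpow_ofNat, one_pow, lintegral_one] at h
  refine (pow_le_pow_left' h 2).trans_eq ?_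
  rw [mul_pow, ← ENNReal.rpow_ofNat, ← ENNReal.rpow_ofNat, ← ENNReal.rpow_mul,
    ← ENNReal.rpow_mul]
  norm_num

lemma average_sq_le {J : Set Circle} {f : Circle → ℂ}
    (hf : AEStronglyMeasurable f normLength) :
    average J f ^ 2 ≤ (∫⁻ ζ in J, ‖f ζ‖ₑ ^ 2 ∂arcLength) / arcLength J := by
  have hac : arcLength ≪ normLength := by
    refine Measure.absolutelyContinuous_smul ?_
    have := Real.pi_pos
    exact (ENNReal.ofReal_pos.2 (by positivity)).ne'
  have h := sq_lintegral_le (arcLength.restrict J)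
    ((hf.mono_ac hac).restrict (s := J)).enorm
  rw [Measure.restrict_apply_univ] at h
  rcases eq_or_ne (arcLength J) 0 with h0 | h0
  · simp [average, Measure.restrict_eq_zero.2 h0]
  have ht : arcLength J ≠ ⊤ := measure_ne_top _ _
  rw [average, div_eq_mul_inv, mul_pow, div_eq_mul_inv]
  calc (∫⁻ ζ in J, ‖f ζ‖ₑ ∂arcLength) ^ 2 * (arcLength J)⁻¹ ^ 2
      ≤ (∫⁻ ζ in J, ‖f ζ‖ₑ ^ 2 ∂arcLength) * arcLength J * (arcLength J)⁻¹ ^ 2 := by gcongr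
    _ = (∫⁻ ζ in J, ‖f ζ‖ₑ ^ 2 ∂arcLength) * (arcLength J)⁻¹ *
          (arcLength J * (arcLength J)⁻¹) := by ring
    _ = _ := by rw [ENNReal.mul_inv_cancel h0 ht, mul_one]

lemma le_localDirichletOn {a b : ℝ} {J : Set Circle} (hJ : arc a b ⊆ J) {f : Circle → ℂ}
    {ξ : Circle} (hξ : ξ ∈ arc a b) (h0 : HasNTLimit f ξ 0) :
    ENNReal.ofReal (8 * Real.pi)⁻¹ *
        ((∫⁻ ζ in arc a b, ‖f ζ‖ₑ ^ 2 ∂arcLength) / arcLength (arc a b)) ≤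
      localDirichletOn J f ξ := by
  rw [localDirichletOn, if_pos ⟨0, h0⟩, h0.bdryValue_eq]
  simp only [sub_zero]
  set σ := arcLength (arc a b)
  have hσ : σ ≠ 0 := by
    obtain ⟨x, hx, -⟩ := hξ
    exact arcLength_arc_ne_zero (hx.1.trans hx.2)
  have h4 : (4 * σ)⁻¹ ≠ ⊤ := ENNReal.inv_ne_top.2 (mul_ne_zero (by norm_num) hσ)
  calc _ = ENNReal.ofReal (2 * Real.pi)⁻¹ *
        ∫⁻ ζ in arc a b, (4 * σ)⁻¹ * ‖f ζ‖ₑ ^ 2 ∂arcLength := by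
        rw [lintegral_const_mul' _ _ h4, ENNReal.mul_inv (by simp) (by simp),
          show (8 * Real.pi)⁻¹ = (2 * Real.pi)⁻¹ * 4⁻¹ by rw [← mul_inv]; congr 1; ring,
          ENNReal.ofReal_mul (by positivity), ENNReal.ofReal_inv_of_pos (by norm_num : (0:ℝ) < 4),
          ENNReal.ofReal_ofNat, div_eq_mul_inv]
        ring
    _ = ∫⁻ ζ in arc a b, (4 * σ)⁻¹ * ‖f ζ‖ₑ ^ 2 ∂normLength := by
        rw [normLength, Measure.restrict_smul, lintegral_smul_measure, smul_eq_mul]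
    _ ≤ ∫⁻ ζ in arc a b, ‖f ζ‖ₑ ^ 2 / ‖(ζ : ℂ) - (ξ : ℂ)‖ₑ ^ 2 ∂normLength := by
        refine setLIntegral_mono' (isOpen_arc _ _).measurableSet fun ζ hζ => ?_
        rw [mul_comm, ← div_eq_mul_inv]
        exact ENNReal.div_le_div_left (enorm_sq_le_arcLength hζ hξ) _
    _ ≤ _ := lintegral_mono_set hJ

lemma measure_mul_le_dirichletOn {μ : Measure Circle} [IsFiniteMeasure μ] {f : Circle → ℂ}
    {E : Set Circle} (hE : MeasurableSet E) (hf : VanishesOn μ f E) {a b : ℝ} {J : Set Circle}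
    (hJ : arc a b ⊆ J) :
    ENNReal.ofReal (8 * Real.pi)⁻¹ *
        ((∫⁻ ζ in arc a b, ‖f ζ‖ₑ ^ 2 ∂arcLength) / arcLength (arc a b)) * μ (E ∩ arc a b) ≤
      dirichletOn J Set.univ μ f := by
  -- The exceptional set has capacity zero, hence `μ`-measure zero.
  have hae : ∀ᵐ ξ ∂μ, ξ ∈ E ∩ arc a b → HasNTLimit f ξ 0 := by
    have h : ∀ᵐ ξ ∂μ, ¬ (ξ ∈ E ∧ ¬ HasNTLimit f ξ 0) := by
      rw [ae_iff]; simpa using measure_eq_zero_of_capacity_eq_zero hf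
    filter_upwards [h] with ξ hξ hm
    exact not_not.1 fun hn => hξ ⟨hm.1, hn⟩
  rw [← setLIntegral_const, dirichletOn, Measure.restrict_univ]
  refine (setLIntegral_mono_ae' (hE.inter (isOpen_arc a b).measurableSet) ?_).trans
    (setLIntegral_le_lintegral _ _)
  filter_upwards [hae] with ξ h hξ
  exact le_localDirichletOn hJ hξ.2 (h hξ)

end HarmonicDirichlet

theorem corollary3p1 (γ : ℝ) (hγ : 1 < γ) :
    ∃ κ : ℝ≥0, 0 < κ ∧
      ∀ (μ : Measure Circle) [IsFiniteMeasure μ] (f : Circle → ℂ) (E : Set Circle) (a b : ℝ),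
        HarmonicDirichlet.MemD μ f → MeasurableSet E → HarmonicDirichlet.VanishesOn μ f E →
        a < b →
        HarmonicDirichlet.average (HarmonicDirichlet.arc a b) f ^ 2 ≤
          (κ : ℝ≥0∞) *
            ((HarmonicDirichlet.dirichletOn (HarmonicDirichlet.dilatedArc γ a b) Set.univ μ f +
                ∫⁻ ζ in HarmonicDirichlet.dilatedArc γ a b,
                  ‖f ζ‖ₑ ^ 2 ∂HarmonicDirichlet.arcLength) /
              μ (E ∩ HarmonicDirichlet.arc a b)) := by
  have hp := Real.pi_pos
  -- `8π` is `2π` from normalizing arc length times 4 from the chord bound.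
  refine ⟨Real.toNNReal (8 * Real.pi), Real.toNNReal_pos.2 (by positivity), ?_⟩
  intro μ _ f E a b hf hE hv hab
  have hsub : HarmonicDirichlet.arc a b ⊆ HarmonicDirichlet.dilatedArc γ a b :=
    HarmonicDirichlet.arc_subset_arc (by nlinarith) (by nlinarith)
  have hD := HarmonicDirichlet.measure_mul_le_dirichletOn hE hv hsub
  refine (HarmonicDirichlet.average_sq_le hf.1.1.aestronglyMeasurable).trans ?_
  have hS : ∫⁻ ζ in HarmonicDirichlet.arc a b, ‖f ζ‖ₑ ^ 2 ∂HarmonicDirichlet.arcLength ≤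
      ∫⁻ ζ in HarmonicDirichlet.dilatedArc γ a b, ‖f ζ‖ₑ ^ 2 ∂HarmonicDirichlet.arcLength :=
    lintegral_mono_set hsub
  set S := ∫⁻ ζ in HarmonicDirichlet.arc a b, ‖f ζ‖ₑ ^ 2 ∂HarmonicDirichlet.arcLength
  set T := ∫⁻ ζ in HarmonicDirichlet.dilatedArc γ a b,
    ‖f ζ‖ₑ ^ 2 ∂HarmonicDirichlet.arcLength
  set D := HarmonicDirichlet.dirichletOn (HarmonicDirichlet.dilatedArc γ a b) Set.univ μ f
  set Q := S / HarmonicDirichlet.arcLength (HarmonicDirichlet.arc a b)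
  rw [show ((Real.toNNReal (8 * Real.pi) : ℝ≥0) : ℝ≥0∞) = ENNReal.ofReal (8 * Real.pi) from rfl]
  have hκ : ENNReal.ofReal (8 * Real.pi) ≠ 0 := (ENNReal.ofReal_pos.2 (by positivity)).ne'
  rcases eq_or_ne (μ (E ∩ HarmonicDirichlet.arc a b)) 0 with h0 | h0
  · rcases eq_or_ne (D + T) 0 with h1 | h1
    -- The case `0/0 = 0`: here the term `∫_{γI} |f|²` forces `f` to vanish almost everywhere on
    -- `I`.
    · have hS0 : S = 0 := le_antisymm (hS.trans (le_add_self.trans h1.le)) zero_le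
      simp [Q, hS0]
    · rw [h0, ENNReal.div_zero h1, ENNReal.mul_top hκ]
      exact le_top
  · rw [← mul_div_assoc, ENNReal.le_div_iff_mul_le (Or.inl h0) (Or.inl (measure_ne_top _ _))]
    calc Q * μ (E ∩ HarmonicDirichlet.arc a b)
        = ENNReal.ofReal (8 * Real.pi) *
          (ENNReal.ofReal (8 * Real.pi)⁻¹ * Q * μ (E ∩ HarmonicDirichlet.arc a b)) := by
          rw [mul_assoc (ENNReal.ofReal _), ← mul_assoc (ENNReal.ofReal (8 * Real.pi)),
            ← ENNReal.ofReal_mul (by positivity), mul_inv_cancel₀ (by positivity),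
            ENNReal.ofReal_one, one_mul]
      _ ≤ ENNReal.ofReal (8 * Real.pi) * (D + T) := by
          gcongr
          exact hD.trans le_self_add
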